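/- Let $n$ be a natural number, let $q\neq 0$ be a complex number with $q^i\neq 1$ for $1\le i\le n$, and write $[N]=\frac{1-q^N}{1-q}$, $(a;q)_N=\prod_{i=1}^{N}(1-aq^{i-1})$ (so $(a;q)_0=1$) and $\genfrac{[}{]}{0pt}{}{n}{r}=\frac{[n][n-1]\cdots[n-r+1]}{[r][r-1]\cdots[1]}$ for $0\le r\le n$. For $x\in\mathbb{C}$ and positive integers $N,s_1,\dots,s_p$ ($p\ge 1$) put, with $i_0=N$, \[ H_N[s_1,\dots,s_p;x]=\frac{q^{N(s_1-1)}}{[N]^{s_1-1}}\sum_{N\ge i_1\ge\cdots\ge i_{p-1}\ge 1}\frac{q^{i_1(s_2-1)+\cdots+i_{p-1}(s_p-1)}}{[i_1]^{s_2}\cdots[i_{p-1}]^{s_p}}\,x^{i_{p-1}}, \] \[ U_N[s_1,\dots,s_p;x]=\frac{1}{[N]^{s_1-1}}\sum_{N\ge i_1\ge\cdots\ge i_{p-1}\ge 1}\frac{q^{i_1+\cdots+i_{p-1}}}{[i_1]^{s_2}\cdots[i_{p-1}]^{s_p}}\,\bigl(1-(x;q)_{i_{p-1}}\bigr), \] where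 for $p=1$ the sums are read as $x^N$ and $1-(x;q)_N$ respectively. Let $\{1\}^s$ denote $s$ copies of the argument $1$; where $\{1\}^{s-1}$ with $s=0$ occurs between two arguments $a+1$ and $b+1$, the segment $a+1,\{1\}^{s-1},b+1$ is understood as the single argument $a+b+1$. Then for every integer $k\ge 1$, all non-negative integers $m_1,\dots,m_k$ and $n_1,\dots,n_k$, and all complex $x,y,z$ such that $yz\neq q^{-r}$ for every integer $r\ge 0$, \[ \begin{aligned} &\sum_{r=1}^{n}\genfrac{[}{]}{0pt}{}{n}{r}(-1)^{r-1}q^{\binom r2}y^r\frac{(z;q)_r}{(yz;q)_r}\,H_r[m_1+1,\{1\}^{n_1-1},m_2+1,\{1\}^{n_2-1},m_3+1,\dots,\{1\}^{n_{k-1}-1},m_k+1,\{1\}^{n_k};x]\\ &\quad=\frac{1}{(yz;q)_n}\sum_{r=1}^{n}\genfrac{[}{]}{0pt}{}{n}{r}y^r(z;q)_r(y;q)_{n-r}\,U_r[\{1\}^{m_1},n_1+1,\{1\}^{m_2-1},n_2+1,\{1\}^{m_3-1},n_3+1,\dots,\{1\}^{m_k-1},n_k+1;x]. \end{aligned} \]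 -/

import Mathlib

open Finset

noncomputable section

namespace QDuality

/-- The `q`-shifted factorial `(x;q)_n = ∏_{i=1}^{n} (1 - x q^{i-1})`, with `(x;q)_0 = 1`. -/
def qPoch (q x : ℂ) (n : ℕ) : ℂ :=
  ∏ i ∈ range n, (1 - x * q ^ i)

/-- The `q`-number `[n] = (1 - q^n) / (1 - q)`. -/
def qNum (q : ℂ) (n : ℕ) : ℂ :=
  (1 - q ^ n) / (1 - q)

/-- The Gaussian binomial coefficient `([n][n-1]⋯[n-r+1]) / ([r][r-1]⋯[1])`. -/
def qBinom (q : ℂ) (n r : ℕ) : ℂ :=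
  (∏ i ∈ range r, qNum q (n - i)) / ∏ i ∈ range r, qNum q (i + 1)

/-- For `l = [s_2, …, s_k]`, the nested sum over `N ≥ i_1 ≥ ⋯ ≥ i_{k-1} ≥ 1` of
`q^{i_1 (s_2 - 1) + ⋯ + i_{k-1} (s_k - 1)} / ([i_1]^{s_2} ⋯ [i_{k-1}]^{s_k}) * x^{i_{k-1}}`,
where `i_0 = N`, so that the value for the empty list is `x^N`. -/
def hSum (q x : ℂ) : ℕ → List ℕ → ℂ
  | N, [] => x ^ N
  | N, s :: l => ∑ i ∈ Icc 1 N, q ^ (i * (s - 1)) / qNum q i ^ s * hSum q x i l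

/-- For `l = [s_2, …, s_k]`, the nested sum over `N ≥ i_1 ≥ ⋯ ≥ i_{k-1} ≥ 1` of
`q^{i_1 + ⋯ + i_{k-1}} / ([i_1]^{s_2} ⋯ [i_{k-1}]^{s_k}) * (1 - (x;q)_{i_{k-1}})`,
where `i_0 = N`, so that the value for the empty list is `1 - (x;q)_N`. -/
def uSum (q x : ℂ) : ℕ → List ℕ → ℂ
  | N, [] => 1 - qPoch q x N
  | N, s :: l => ∑ i ∈ Icc 1 N, q ^ i / qNum q i ^ s * uSum q x i l

/-- The generalized `q`-multiple harmonic sum `H_N[s_1, …, s_k; x]`, for a non-empty list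
of positive integers `s_1, …, s_k` (the value at the empty list is irrelevant). -/
def H (q x : ℂ) (N : ℕ) : List ℕ → ℂ
  | [] => 0
  | s :: l => q ^ (N * (s - 1)) / qNum q N ^ (s - 1) * hSum q x N l

/-- The generalized `q`-multiple harmonic sum `U_N[s_1, …, s_k; x]`, for a non-empty list
of positive integers `s_1, …, s_k` (the value at the empty list is irrelevant). -/
def U (q x : ℂ) (N : ℕ) : List ℕ → ℂ
  | [] => 0
  | s :: l => 1 / qNum q N ^ (s - 1) * uSum q x N l

/-- With `(m, n) = (m_1, n_1)` and the list `(m_2, n_2), …, (m_k, n_k)`, the argument list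
`m_1 + 1, {1}^{n_1 - 1}, m_2 + 1, {1}^{n_2 - 1}, …, {1}^{n_{k-1} - 1}, m_k + 1, {1}^{n_k}`,
where, by convention, `a + 1, {1}^{0 - 1}, b + 1` stands for the single entry `a + b + 1`. -/
def hIndexAux : ℕ → ℕ → List (ℕ × ℕ) → List ℕ
  | m, n, [] => (m + 1) :: List.replicate n 1
  | m, 0, (m', n') :: rest => hIndexAux (m + m') n' rest
  | m, n + 1, (m', n') :: rest => (m + 1) :: (List.replicate n 1 ++ hIndexAux m' n' rest)

/-- With `n = n_1` and the list `(m_2, n_2), …, (m_k, n_k)`, the argument list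
`n_1 + 1, {1}^{m_2 - 1}, n_2 + 1, {1}^{m_3 - 1}, …, {1}^{m_k - 1}, n_k + 1`,
where, by convention, `a + 1, {1}^{0 - 1}, b + 1` stands for the single entry `a + b + 1`. -/
def uIndexAux : ℕ → List (ℕ × ℕ) → List ℕ
  | n, [] => [n + 1]
  | n, (0, n') :: rest => uIndexAux (n + n') rest
  | n, (m' + 1, n') :: rest => (n + 1) :: (List.replicate m' 1 ++ uIndexAux n' rest)

/-- The argument list
`m_1 + 1, {1}^{n_1 - 1}, m_2 + 1, …, {1}^{n_{k-1} - 1}, m_k + 1, {1}^{n_k}`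
of `H`, formed from the pairs `(m_1, n_1), …, (m_k, n_k)`, `k ≥ 1`. -/
def hIndex : List (ℕ × ℕ) → List ℕ
  | [] => []
  | (m, n) :: rest => hIndexAux m n rest

/-- The argument list `{1}^{m_1}, n_1 + 1, {1}^{m_2 - 1}, n_2 + 1, …, {1}^{m_k - 1}, n_k + 1`
of `U`, formed from the pairs `(m_1, n_1), …, (m_k, n_k)`, `k ≥ 1`. -/
def uIndex : List (ℕ × ℕ) → List ℕ
  | [] => []
  | (m, n) :: rest => List.replicate m 1 ++ uIndexAux n rest

end QDuality

end

open Finset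

namespace QDuality

/-! The link between `H` and `U` is the `q`-binomial transform `qTransform`: it sends `H_r[h; x]` to
`U_N[u; x]` for the two index lists of the theorem (`qTransform_H_hIndex`). The seed is the
`q`-binomial theorem, which sends `x^r` to `1 - (x;q)_N`. Two rules build everything else:
multiplying `F(r)` by `q^r/[r]` becomes summation against `q^i/[i]` (`qTransform_pow_div_mul`), and
summing `F(i)/[i]` becomes division by `[N]` (`qTransform_sum_div`). On index lists these raise the
head of one list and prepend a `1` to the other, and such moves generate every pair of lists.

It remains to substitute `U = qTransform H` on the right and swap the two sums; the inner sum is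
then a `q`-Vandermonde sum (`sum_mul_qTransform`). -/

variable {q x : ℂ} {N : ℕ}

/-! ### Gaussian binomials and shifted factorials -/

/-- The `q`-factorial `[N][N-1]⋯[1]`. -/
noncomputable def qFact (q : ℂ) (N : ℕ) : ℂ :=
  ∏ i ∈ range N, qNum q (i + 1)

/-- The `q`-numbers `[1], …, [N]` do not vanish. -/
def Regular (q : ℂ) (N : ℕ) : Prop :=
  ∀ i, 1 ≤ i → i ≤ N → qNum q i ≠ 0

lemma Regular.mono {M : ℕ} (h : Regular q N) (hM : M ≤ N) : Regular q M :=
  fun i h1 h2 => h i h1 (h2.trans hM)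

lemma Regular.ne_one (h : Regular q (N + 1)) : q ≠ 1 := by
  rintro rfl
  exact h 1 le_rfl (by omega) (by simp [qNum])

lemma qFact_succ (q : ℂ) (N : ℕ) : qFact q (N + 1) = qFact q N * qNum q (N + 1) :=
  prod_range_succ _ _

lemma Regular.qFact_ne_zero (h : Regular q N) : qFact q N ≠ 0 :=
  prod_ne_zero_iff.2 fun i hi => h (i + 1) (by omega) (by have := mem_range.1 hi; omega)

lemma prod_qNum_mul_qFact (q : ℂ) (r t : ℕ) :
    (∏ i ∈ range r, qNum q (r + t - i)) * qFact q t = qFact q (r + t) := by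
  induction r generalizing t with
  | zero => simp
  | succ r ih =>
    rw [prod_range_succ, show r + 1 + t - r = t + 1 by omega, mul_assoc, mul_comm (qNum q _),
      ← qFact_succ, show r + 1 + t = r + (t + 1) by omega, ih]

lemma qBinom_add (h : Regular q N) {r t : ℕ} (ht : r + t ≤ N) :
    qBinom q (r + t) r = qFact q (r + t) / (qFact q r * qFact q t) := by
  have ht0 : qFact q t ≠ 0 := (h.mono (by omega)).qFact_ne_zero
  rw [← prod_qNum_mul_qFact, mul_div_mul_right _ _ ht0]
  rfl

@[simp] lemma qBinom_zero_right (q : ℂ) (N : ℕ) : qBinom q N 0 = 1 := by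
  simp [qBinom]

lemma qBinom_self_succ (q : ℂ) (N : ℕ) : qBinom q N (N + 1) = 0 := by
  rw [qBinom, prod_range_succ]
  simp [qNum]

/-- Both sides are the `q`-multinomial `[N]!/([s]! [t]! [u]!)`. -/
lemma qBinom_mul_qBinom (h : Regular q N) {s t u : ℕ} (hN : s + t + u = N) :
    qBinom q N (s + t) * qBinom q (s + t) s = qBinom q N s * qBinom q (t + u) t := by
  subst hN
  rw [qBinom_add h le_rfl, qBinom_add h (by omega), qBinom_add h (by omega : t + u ≤ s + t + u)]
  conv_rhs => rw [add_assoc, qBinom_add h (by omega)]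
  have h1 : qFact q s ≠ 0 := (h.mono (by omega)).qFact_ne_zero
  have h2 : qFact q t ≠ 0 := (h.mono (by omega)).qFact_ne_zero
  have h3 : qFact q u ≠ 0 := (h.mono (by omega)).qFact_ne_zero
  have h4 : qFact q (s + t) ≠ 0 := (h.mono (by omega)).qFact_ne_zero
  have h5 : qFact q (t + u) ≠ 0 := (h.mono (by omega)).qFact_ne_zero
  rw [add_assoc]
  field_simp

lemma qBinom_succ_right (q : ℂ) (N r : ℕ) :
    qBinom q N (r + 1) = qBinom q N r * (qNum q (N - r) / qNum q (r + 1)) := by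
  rw [qBinom, prod_range_succ, prod_range_succ, mul_div_mul_comm]
  rfl

lemma qBinom_succ_succ (q : ℂ) (N r : ℕ) :
    qBinom q (N + 1) (r + 1) = qBinom q N r * (qNum q (N + 1) / qNum q (r + 1)) := by
  rw [qBinom, prod_range_succ', prod_range_succ, mul_div_mul_comm]
  simp [qBinom]

lemma qNum_add (hq : q ≠ 1) (a b : ℕ) : qNum q (a + b) = qNum q a + q ^ a * qNum q b := by
  have : 1 - q ≠ 0 := sub_ne_zero.2 hq.symm
  simp only [qNum]
  field_simp
  ring

lemma qBinom_pascal (h : Regular q (N + 1)) {r : ℕ} (hr : r ≤ N) :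
    qBinom q (N + 1) (r + 1) = qBinom q N (r + 1) + q ^ (N - r) * qBinom q N r := by
  have h0 := h (r + 1) (by omega) (by omega)
  have h1 := qNum_add h.ne_one (N - r) (r + 1)
  rw [show N - r + (r + 1) = N + 1 by omega] at h1
  rw [qBinom_succ_succ, qBinom_succ_right, h1]
  field_simp

lemma qBinom_pascal' (h : Regular q (N + 1)) {r : ℕ} (hr : r ≤ N) :
    qBinom q (N + 1) (r + 1) = qBinom q N r + q ^ (r + 1) * qBinom q N (r + 1) := by
  have h0 := h (r + 1) (by omega) (by omega)
  have h1 := qNum_add h.ne_one (r + 1) (N - r)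
  rw [show r + 1 + (N - r) = N + 1 by omega] at h1
  rw [qBinom_succ_succ, qBinom_succ_right, h1]
  field_simp

lemma qPoch_succ (q x : ℂ) (N : ℕ) : qPoch q x (N + 1) = qPoch q x N * (1 - x * q ^ N) :=
  prod_range_succ _ _

lemma qPoch_add (q x : ℂ) (a b : ℕ) :
    qPoch q x (a + b) = qPoch q x a * qPoch q (x * q ^ a) b := by
  simp only [qPoch, prod_range_add, pow_add, mul_assoc]

lemma qPoch_ne_zero (hx : ∀ r : ℕ, x ≠ q ^ (-(r : ℤ))) (N : ℕ) :
    qPoch q x N ≠ 0 := by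
  refine prod_ne_zero_iff.2 fun i _ h => hx i ?_
  rw [zpow_neg, zpow_natCast]
  exact eq_inv_of_mul_eq_one_left (sub_eq_zero.1 h).symm

/-- Pascal's rule, summed against an arbitrary sequence. -/
lemma sum_qBinom_succ (h : Regular q (N + 1)) (f : ℕ → ℂ) :
    ∑ r ∈ range (N + 2), qBinom q (N + 1) r * f r =
      ∑ r ∈ range (N + 1), qBinom q N r * (f r + q ^ (N - r) * f (r + 1)) := by
  have h1 : ∑ r ∈ range (N + 1), qBinom q N r * f r =
      ∑ r ∈ range (N + 1), qBinom q N (r + 1) * f (r + 1) + f 0 := by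
    have := sum_range_succ' (fun r => qBinom q N r * f r) (N + 1)
    rw [sum_range_succ, qBinom_self_succ] at this
    simpa using this
  simp only [mul_add, sum_add_distrib]
  rw [sum_range_succ', h1, add_right_comm, ← sum_add_distrib, qBinom_zero_right, one_mul]
  congr 1
  refine sum_congr rfl fun r hr => ?_
  rw [qBinom_pascal h (by have := mem_range.1 hr; omega)]
  ring

/-- The `q`-Vandermonde identity. -/
lemma sum_qBinom_mul_qPoch (h : Regular q N) (y z : ℂ) :
    ∑ r ∈ range (N + 1), qBinom q N r * (y ^ r * qPoch q z r * qPoch q y (N - r)) =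
      qPoch q (y * z) N := by
  induction N with
  | zero => simp [qPoch]
  | succ N ih =>
    rw [sum_qBinom_succ h, qPoch_succ, ← ih (h.mono (by omega)), sum_mul]
    refine sum_congr rfl fun r hr => ?_
    obtain ⟨t, rfl⟩ := Nat.exists_eq_add_of_le (Nat.lt_succ_iff.1 (mem_range.1 hr))
    -- The identity behind this is `(1 - y q^t) + q^t y (1 - z q^r) = 1 - y z q^(r+t)`.
    rw [show r + t + 1 - r = t + 1 by omega, show r + t + 1 - (r + 1) = t by omega,
      show r + t - r = t by omega, qPoch_succ, qPoch_succ]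
    ring

/-- The `q`-binomial theorem. -/
lemma sum_qBinom_mul_pow (h : Regular q N) (x : ℂ) :
    ∑ r ∈ range (N + 1), qBinom q N r * ((-1) ^ r * q ^ r.choose 2 * x ^ r) = qPoch q x N := by
  induction N with
  | zero => simp [qPoch]
  | succ N ih =>
    rw [sum_qBinom_succ h, qPoch_succ, ← ih (h.mono (by omega)), sum_mul]
    refine sum_congr rfl fun r hr => ?_
    obtain ⟨t, rfl⟩ := Nat.exists_eq_add_of_le (Nat.lt_succ_iff.1 (mem_range.1 hr))
    rw [show r + t - r = t by omega, Nat.choose_succ_succ' r 1, Nat.choose_one_right]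
    ring

/-! ### The `q`-binomial transform and its two rules -/

/-- The `q`-binomial transform `∑_{r=1}^N (-1)^{r-1} q^{r(r-1)/2} (N choose r)_q F(r)`. -/
noncomputable def qTransform (q : ℂ) (F : ℕ → ℂ) (N : ℕ) : ℂ :=
  ∑ r ∈ Icc 1 N, (-1) ^ (r - 1) * q ^ r.choose 2 * qBinom q N r * F r

lemma sum_Icc_one (f : ℕ → ℂ) (N : ℕ) : ∑ r ∈ Icc 1 N, f r = ∑ r ∈ range N, f (r + 1) := by
  rw [range_eq_Ico, sum_Ico_add' f 0 N 1]
  rfl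

lemma qTransform_eq_sum_range (q : ℂ) (F : ℕ → ℂ) (N : ℕ) :
    qTransform q F N =
      ∑ r ∈ range N, (-1) ^ r * q ^ (r + 1).choose 2 * qBinom q N (r + 1) * F (r + 1) :=
  sum_Icc_one _ _

lemma qTransform_pow (h : Regular q N) (x : ℂ) :
    qTransform q (fun r => x ^ r) N = 1 - qPoch q x N := by
  rw [← sum_qBinom_mul_pow h, sum_range_succ', qTransform_eq_sum_range]
  simp only [qBinom_zero_right, pow_zero, Nat.choose_zero_succ, mul_one, sub_add_cancel_right,
    ← sum_neg_distrib]
  exact sum_congr rfl fun r _ => by ring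

/-- Compare increments in `N`. By Pascal's rule the coefficient of index `r` grows by `q^(N+1-r)
[r]/[N+1]` times the binomial `(N+1 choose r)_q`; the weight `q^r/[r]` turns this factor into
`q^(N+1)/[N+1]`, independent of `r`. -/
lemma qTransform_pow_div_mul (h : Regular q N) (F : ℕ → ℂ) :
    qTransform q (fun r => q ^ r / qNum q r * F r) N =
      ∑ i ∈ Icc 1 N, q ^ i / qNum q i * qTransform q F i := by
  induction N with
  | zero => simp [qTransform]
  | succ N ih =>
    rw [sum_Icc_succ_top (by omega), ← ih (h.mono (by omega))]
    -- A vanishing term of index `N + 1` is added so that both transforms have the same range.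
    have h0 : qTransform q (fun r => q ^ r / qNum q r * F r) N =
        ∑ r ∈ range (N + 1), (-1) ^ r * q ^ (r + 1).choose 2 * qBinom q N (r + 1) *
          (q ^ (r + 1) / qNum q (r + 1) * F (r + 1)) := by
      rw [qTransform_eq_sum_range, sum_range_succ, qBinom_self_succ]
      simp
    rw [h0, qTransform_eq_sum_range, qTransform_eq_sum_range, mul_sum, ← sum_add_distrib]
    refine sum_congr rfl fun r hr => ?_
    obtain ⟨t, rfl⟩ := Nat.exists_eq_add_of_le (Nat.lt_succ_iff.1 (mem_range.1 hr))
    have h1 := h (r + 1) (by omega) (by omega)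
    have h2 := h (r + t + 1) (by omega) (by omega)
    have h3 := qBinom_succ_succ q (r + t) r
    have h4 := qBinom_pascal h (r := r) (by omega)
    rw [show r + t - r = t by omega] at h4
    have h5 : qBinom q (r + t) r * qNum q (r + t + 1) =
        qBinom q (r + t + 1) (r + 1) * qNum q (r + 1) := by
      rw [h3]; field_simp
    have h6 : qBinom q (r + t) (r + 1) * qNum q (r + t + 1) =
        qBinom q (r + t + 1) (r + 1) * (qNum q (r + t + 1) - q ^ t * qNum q (r + 1)) := by
      linear_combination (-qNum q (r + t + 1)) * h4 - q ^ t * h5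
    field_simp
    linear_combination (-q ^ (r + 1) * F (r + 1) * q ^ (r + 1).choose 2) * h6

/-- Abel summation, with the boundary term kept. -/
lemma sum_sub_succ_mul_sum (t g : ℕ → ℂ) (M : ℕ) :
    ∑ r ∈ range M, (t r - t (r + 1)) * ∑ i ∈ range (r + 1), g i =
      ∑ r ∈ range M, t r * g r - t M * ∑ i ∈ range M, g i := by
  induction M with
  | zero => simp
  | succ M ih =>
    rw [sum_range_succ, ih, sum_range_succ, sum_range_succ]
    ring

/-- The second Pascal rule makes the signed coefficients telescope, so Abel summation removes the
inner sum; the quotient of the remaining coefficient by `[r+1]` is the original one divided by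
`[N]`. -/
lemma qTransform_sum_div (h : Regular q N) (hN : 1 ≤ N) (F : ℕ → ℂ) :
    qTransform q (fun r => ∑ i ∈ Icc 1 r, F i / qNum q i) N = qTransform q F N / qNum q N := by
  obtain ⟨N, rfl⟩ := Nat.exists_eq_add_of_le' hN
  have key := sum_sub_succ_mul_sum (fun r => (-1) ^ r * q ^ (r + 1).choose 2 * qBinom q N r)
    (fun i => F (i + 1) / qNum q (i + 1)) (N + 1)
  rw [qBinom_self_succ] at key
  rw [qTransform_eq_sum_range, qTransform_eq_sum_range, sum_div]
  simp only [sum_Icc_one]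
  rw [mul_zero, zero_mul, sub_zero] at key
  refine Eq.trans (sum_congr rfl fun r hr => ?_) (key.trans (sum_congr rfl fun r hr => ?_))
  · rw [qBinom_pascal' h (by have := mem_range.1 hr; omega), Nat.choose_succ_succ' (r + 1) 1,
      Nat.choose_one_right]
    ring
  · have h1 := h (r + 1) (by omega) (by have := mem_range.1 hr; omega)
    have h2 := h (N + 1) (by omega) (by omega)
    rw [qBinom_succ_succ]
    field_simp

/-! ### Dual index lists -/

/-- Increase the first entry of a list by one. -/
def raiseHead : List ℕ → List ℕ
  | [] => []
  | s :: l => (s + 1) :: l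

lemma hIndexAux_succ (m n : ℕ) (rest : List (ℕ × ℕ)) :
    hIndexAux (m + 1) n rest = raiseHead (hIndexAux m n rest) := by
  induction rest generalizing m n with
  | nil => rfl
  | cons p rest ih =>
    cases n with
    | zero => simp only [hIndexAux, ← ih, add_right_comm]
    | succ n => rfl

lemma hIndexAux_zero_succ (n : ℕ) (rest : List (ℕ × ℕ)) :
    hIndexAux 0 (n + 1) rest = 1 :: hIndexAux 0 n rest := by
  cases rest with
  | nil => rfl
  | cons p rest =>
    cases n with
    | zero => simp [hIndexAux]
    | succ n => rfl

lemma uIndexAux_succ (n : ℕ) (rest : List (ℕ × ℕ)) :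
    uIndexAux (n + 1) rest = raiseHead (uIndexAux n rest) := by
  induction rest generalizing n with
  | nil => rfl
  | cons p rest ih =>
    obtain ⟨m, n'⟩ := p
    cases m with
    | zero => simp only [uIndexAux, ← ih, add_right_comm]
    | succ m => rfl

lemma uIndexAux_zero_cons (m n : ℕ) (rest : List (ℕ × ℕ)) :
    uIndexAux 0 ((m, n) :: rest) = List.replicate m 1 ++ uIndexAux n rest := by
  cases m with
  | zero => simp [uIndexAux]
  | succ m => rfl

/-- `h` and `u` are lists with positive first entry such that `U[u]` is the `q`-binomial
transform of `H[h]` up to `N`. -/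
def IsDualPair (q x : ℂ) (N : ℕ) (h u : List ℕ) : Prop :=
  (∃ a l, h = (a + 1) :: l) ∧ (∃ b l, u = (b + 1) :: l) ∧
    ∀ r, 1 ≤ r → r ≤ N → qTransform q (fun i => H q x i h) r = U q x r u

lemma isDualPair_one (hq : Regular q N) : IsDualPair q x N [1] [1] := by
  refine ⟨⟨0, _, rfl⟩, ⟨0, _, rfl⟩, fun r _ hr => ?_⟩
  simpa [H, U, hSum, uSum] using qTransform_pow (hq.mono hr) x

/-- Raising the head of `h` multiplies `H_i` by `q^i/[i]`, so `qTransform_pow_div_mul` applies. The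
old head `b + 1` of `u` becomes an inner entry: its prefactor `1/[i]^b` absorbs the new `1/[i]`. -/
lemma IsDualPair.raise_left {h u : List ℕ} (hq : Regular q N) (H' : IsDualPair q x N h u) :
    IsDualPair q x N (raiseHead h) (1 :: u) := by
  obtain ⟨⟨a, l, rfl⟩, ⟨b, l', rfl⟩, e⟩ := H'
  refine ⟨⟨a + 1, _, rfl⟩, ⟨0, _, rfl⟩, fun r _ hr => ?_⟩
  have h1 : (fun i => H q x i (raiseHead ((a + 1) :: l))) =
      fun i => q ^ i / qNum q i * H q x i ((a + 1) :: l) := by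
    funext i
    simp only [raiseHead, H, Nat.add_sub_cancel, mul_add, mul_one, pow_add, pow_one]
    rw [mul_div_mul_comm]
    ring
  rw [h1, qTransform_pow_div_mul (hq.mono hr)]
  simp only [U, uSum, Nat.sub_self, pow_zero, div_one, one_mul]
  refine sum_congr rfl fun i hi => ?_
  obtain ⟨hi1, hi2⟩ := mem_Icc.1 hi
  rw [e i hi1 (by omega)]
  simp only [U, Nat.add_sub_cancel, pow_succ, div_eq_mul_inv, mul_inv]
  ring

/-- A leading `1` in `h` turns `H` into partial sums of `H_j/[j]`, and `qTransform_sum_div` returns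
the extra factor `1/[r]` that raises the head of `u`. -/
lemma IsDualPair.raise_right {h u : List ℕ} (hq : Regular q N) (H' : IsDualPair q x N h u) :
    IsDualPair q x N (1 :: h) (raiseHead u) := by
  obtain ⟨⟨a, l, rfl⟩, ⟨b, l', rfl⟩, e⟩ := H'
  refine ⟨⟨0, _, rfl⟩, ⟨b + 1, _, rfl⟩, fun r hr1 hr => ?_⟩
  have h1 : (fun i => H q x i (1 :: (a + 1) :: l)) =
      fun i => ∑ j ∈ Icc 1 i, H q x j ((a + 1) :: l) / qNum q j := by
    funext i
    simp only [H, hSum, Nat.sub_self, mul_zero, pow_zero, div_one, one_mul]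
    refine sum_congr rfl fun j _ => ?_
    simp only [Nat.add_sub_cancel, pow_succ, div_eq_mul_inv, mul_inv]
    ring
  rw [h1, qTransform_sum_div (hq.mono hr) hr1, e r hr1 hr]
  simp only [U, raiseHead, Nat.add_sub_cancel, pow_succ, div_eq_mul_inv, mul_inv]
  ring

/-- Each unit of `m` is one `raise_left`. Once `m = 0`, each unit of `n` is one `raise_right`. -/
lemma isDualPair_indexAux (hq : Regular q N) (m n : ℕ) (rest : List (ℕ × ℕ)) :
    IsDualPair q x N (hIndexAux m n rest) (List.replicate m 1 ++ uIndexAux n rest) := by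
  induction rest generalizing m n with
  | nil =>
    induction m with
    | succ m ih => rw [hIndexAux_succ]; exact ih.raise_left hq
    | zero =>
      induction n with
      | zero => exact isDualPair_one hq
      | succ n ih => rw [hIndexAux_zero_succ, uIndexAux_succ]; exact ih.raise_right hq
  | cons p rest ihr =>
    induction m with
    | succ m ih => rw [hIndexAux_succ]; exact ih.raise_left hq
    | zero =>
      induction n with
      | zero =>
        -- A leading pair `(0, 0)` contributes nothing: by the merging convention both lists are
        -- those of the remaining pairs.
        obtain ⟨m', n'⟩ := p
        rw [uIndexAux_zero_cons, hIndexAux, Nat.zero_add]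
        exact ihr m' n'
      | succ n ih => rw [hIndexAux_zero_succ, uIndexAux_succ]; exact ih.raise_right hq

/-- The duality between `H` and `U` under the `q`-binomial transform. -/
lemma qTransform_H_hIndex (hq : Regular q N) {l : List (ℕ × ℕ)} (hl : l ≠ []) {r : ℕ}
    (hr1 : 1 ≤ r) (hr : r ≤ N) :
    qTransform q (fun i => H q x i (hIndex l)) r = U q x r (uIndex l) := by
  obtain ⟨⟨m, n⟩, rest, rfl⟩ := List.exists_cons_of_ne_nil hl
  exact (isDualPair_indexAux hq m n rest).2.2 r hr1 hr

/-! ### The weighted sum over the transform -/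

/-- With `r = s + t`, the binomial product and `(z;q)_(s+t)` split off their `s`-parts, leaving
`q`-Vandermonde of length `N - s` with `z q^s` in place of `z`. -/
lemma sum_Icc_qBinom_mul_qBinom (h : Regular q N) {s : ℕ} (hs : s ≤ N) (y z : ℂ) :
    ∑ r ∈ Icc s N, qBinom q N r * y ^ r * qPoch q z r * qPoch q y (N - r) * qBinom q r s =
      qBinom q N s * y ^ s * qPoch q z s * qPoch q (y * z * q ^ s) (N - s) := by
  obtain ⟨u, rfl⟩ := Nat.exists_eq_add_of_le hs
  rw [Nat.add_sub_cancel_left, mul_assoc y z, ← sum_qBinom_mul_qPoch (h.mono (by omega)), mul_sum,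
    range_eq_Ico]
  have := sum_Ico_add' (fun r => qBinom q (s + u) r * y ^ r * qPoch q z r * qPoch q y (s + u - r) *
    qBinom q r s) 0 (u + 1) s
  rw [show Icc s (s + u) = Ico (0 + s) (u + 1 + s) by ext i; simp; omega, ← this]
  refine sum_congr rfl fun t ht => ?_
  obtain ⟨v, rfl⟩ := Nat.exists_eq_add_of_le (Nat.lt_succ_iff.1 (mem_Ico.1 ht).2)
  have key := qBinom_mul_qBinom h (s := s) (t := t) (u := v) (by omega)
  rw [add_comm t s, qPoch_add, show s + (t + v) - (s + t) = v by omega,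
    show t + v - t = v by omega, pow_add]
  linear_combination (y ^ s * y ^ t * (qPoch q z s * qPoch q (z * q ^ s) t) * qPoch q y v) * key

/-- The `q`-binomial transform of `F` weighted by `(z;q)_r (y;q)_{N-r}` in terms of `F`. -/
lemma sum_mul_qTransform (h : Regular q N) (y z : ℂ) (hyz : ∀ r, qPoch q (y * z) r ≠ 0)
    (F : ℕ → ℂ) :
    1 / qPoch q (y * z) N * ∑ r ∈ Icc 1 N,
        qBinom q N r * y ^ r * qPoch q z r * qPoch q y (N - r) * qTransform q F r =
      ∑ r ∈ Icc 1 N, qBinom q N r * (-1) ^ (r - 1) * q ^ r.choose 2 * y ^ r *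
        (qPoch q z r / qPoch q (y * z) r) * F r := by
  simp only [qTransform, mul_sum]
  rw [sum_comm' (t' := Icc 1 N) (s' := fun s => Icc s N)
    (by intro a b; simp only [mem_Icc]; omega)]
  refine sum_congr rfl fun s hs => ?_
  have hs' := (mem_Icc.1 hs).2
  have h1 := sum_Icc_qBinom_mul_qBinom h hs' y z
  have h2 := qPoch_add q (y * z) s (N - s)
  rw [Nat.add_sub_cancel' hs'] at h2
  have h3 := hyz s
  have h4 := hyz N
  -- The numerator cancels the prefactor `1/(yz;q)_N`, leaving the weight `1/(yz;q)_s`.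
  have h5 : qPoch q (y * z * q ^ s) (N - s) = qPoch q (y * z) N / qPoch q (y * z) s := by
    rw [h2]; field_simp
  rw [h5] at h1
  trans 1 / qPoch q (y * z) N * ((-1) ^ (s - 1) * q ^ s.choose 2 * F s) *
    ∑ r ∈ Icc s N, qBinom q N r * y ^ r * qPoch q z r * qPoch q y (N - r) * qBinom q r s
  · rw [mul_sum]
    exact sum_congr rfl fun r _ => by ring
  · rw [h1]
    field_simp

end QDuality

theorem proposition20 (q : ℂ) (hq0 : q ≠ 0) (n : ℕ)
    (hq : ∀ i : ℕ, 1 ≤ i → i ≤ n → q ^ i ≠ 1)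
    (x y z : ℂ) (hyz : ∀ r : ℕ, y * z ≠ q ^ (-(r : ℤ)))
    (k : ℕ) (hk : 1 ≤ k) (ms ns : Fin k → ℕ) :
    ∑ r ∈ Finset.Icc 1 n,
        QDuality.qBinom q n r * (-1) ^ (r - 1) * q ^ (r.choose 2) * y ^ r *
          (QDuality.qPoch q z r / QDuality.qPoch q (y * z) r) *
          QDuality.H q x r (QDuality.hIndex (List.ofFn fun j => (ms j, ns j))) =
      1 / QDuality.qPoch q (y * z) n *
        ∑ r ∈ Finset.Icc 1 n,
          QDuality.qBinom q n r * y ^ r * QDuality.qPoch q z r * QDuality.qPoch q y (n - r) *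
            QDuality.U q x r (QDuality.uIndex (List.ofFn fun j => (ms j, ns j))) := by
  have hreg : QDuality.Regular q n := fun i h1 h2 =>
    div_ne_zero (sub_ne_zero.2 (hq i h1 h2).symm)
      -- `q ≠ 1` is the hypothesis at exponent `1`, which is in range because `1 ≤ i ≤ n`.
      (sub_ne_zero.2 fun h => hq 1 le_rfl (h1.trans h2) (by rw [pow_one, ← h]))
  have hl : (List.ofFn fun j => (ms j, ns j)) ≠ [] := by
    rw [Ne, List.ofFn_eq_nil_iff]
    omega
  rw [← QDuality.sum_mul_qTransform hreg y z (QDuality.qPoch_ne_zero hyz)]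
  congr 1
  refine Finset.sum_congr rfl fun r hr => ?_
  obtain ⟨h1, h2⟩ := Finset.mem_Icc.1 hr
  rw [QDuality.qTransform_H_hIndex hreg hl h1 h2]
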